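/- Let $\kappa$ be an infinite regular cardinal. A model category $\mathcal K$ is called $\kappa$-combinatorial if it is locally $\kappa$-presentable and if there are sets $\mathcal I$ and $\mathcal J$ of morphisms between $\kappa$-presentable objects such that the trivial fibrations are exactly the morphisms with the right lifting property with respect to $\mathcal I$, and the fibrations are exactly the morphisms with the right lifting property with respect to $\mathcal J$ (that is, cofibrations and trivial cofibrations are cofibrantly generated by $\mathcal I$ and $\mathcal J$). An object $K$ of a model category is called acyclic if the morphism $K\to 1$ to the terminal object is a weak equivalence. **Corollary.** Let $\mathcal K$ be a $\kappa$-combinatorial model category in which the terminal object $1$ is $\kappa$-presentable, and such that for every acyclic object $K$ the morphism $K\to 1$ is split by a cofibration, i.e. there is a cofibration $s\colon 1\to K$ whose composite with $K\to 1$ is $\mathrm{id}_1$. Then every acyclic object of $\mathcal K$ is a $\kappa$-directed colimit of $\kappa$-presentable acyclic objects, i.e. the colimit of a diagram of such objects indexed by a (small) partially ordered set in which every subset of cardinality $<\kappa$ has an upper bound. In particular, for the Kan–Quillen model structure on simplicial sets (the model structure whose cofibrations are the monomorphisms and whose fibrations are the Kan fibrations), every acyclic simplicial set is a directed colimit of finitely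 presentable acyclic simplicial sets. -/

import Mathlib

open CategoryTheory Limits HomotopicalAlgebra

universe w v u

/-- An object `K` of a model category is acyclic if the morphism from `K` to the terminal object
is a weak equivalence. -/
def acyclicObjects (C : Type u) [Category.{v} C] [ModelCategory C] : ObjectProperty C :=
  fun K ↦ WeakEquivalence (terminal.from K)

/-- A class of morphisms `R` (the right class of a weak factorization system) is cofibrantly
generated by a (`w`-small) set of morphisms between `κ`-presentable objects: there is such a
set `X` with `R` the class of all morphisms having the right lifting property
with respect to `X`. -/
def IsCofibrantlyGeneratedByPresentable {C : Type u} [Category.{v} C] (R : MorphismProperty C)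
    (κ : Cardinal.{w}) [Fact κ.IsRegular] : Prop :=
  ∃ X : MorphismProperty C, MorphismProperty.IsSmall.{w} X ∧
    (∀ ⦃A B : C⦄ (f : A ⟶ B), X f → IsCardinalPresentable A κ ∧ IsCardinalPresentable B κ) ∧
    R = X.rlp

/-- A model category is `κ`-combinatorial if it is locally `κ`-presentable and both weak
factorization systems (cofibrations, trivial fibrations) and (trivial cofibrations, fibrations)
are cofibrantly generated by sets of morphisms between `κ`-presentable objects. -/
class IsCardinalCombinatorial (C : Type u) [Category.{v} C] [ModelCategory C]
    (κ : Cardinal.{w}) [Fact κ.IsRegular] : Prop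
    extends IsCardinalLocallyPresentable C κ where
  cofibrations_generated : IsCofibrantlyGeneratedByPresentable (trivialFibrations C) κ
  trivialCofibrations_generated : IsCofibrantlyGeneratedByPresentable (fibrations C) κ

/-- The object `K` is the colimit of a diagram of objects satisfying `P` which is indexed by a
(`w`-small) `κ`-directed partially ordered set, that is, by a poset in which each subset of
cardinality `< κ` has an upper bound. -/
def IsCardinalDirectedColimitOf {C : Type u} [Category.{v} C] (P : ObjectProperty C)
    (κ : Cardinal.{w}) [Fact κ.IsRegular] (K : C) : Prop :=
  ∃ (S : Type w) (_ : PartialOrder S) (D : S ⥤ C) (c : Cocone D) (_ : IsColimit c),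
    (∀ T : Set S, Cardinal.mk T < κ → BddAbove T) ∧ (∀ s, P (D.obj s)) ∧ Nonempty (c.pt ≅ K)

/-- A model structure on the category of simplicial sets is the Kan–Quillen one if its
cofibrations are the monomorphisms and its fibrations are the Kan fibrations, i.e. the
morphisms with the right lifting property with respect to all horn inclusions
(the weak equivalences are determined by these two classes). -/
def IsKanQuillen (M : ModelCategory SSet.{w}) : Prop :=
  M.categoryWithCofibrations.cofibrations = MorphismProperty.monomorphisms SSet.{w} ∧
    M.categoryWithFibrations.fibrations = SSet.modelCategoryQuillen.J.{w}.rlp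

/-! By two-out-of-three, a cofibration `s : 1 ⟶ K` into an acyclic object is a trivial cofibration,
that is, a member of `J.rlp.llp`. The crux is that every `a : A ⟶ K` in this class with `A`
κ-presentable satisfies `IsPresentablyFactorizable`. For `A = 1` the intermediate objects `P` are
acyclic, so they are cofinal in the canonical diagram of κ-presentable objects over `K`, and
`isCardinalDirectedColimitOf_of_exists_fac` concludes.

Factorizability has two proofs. If `κ > ℵ₀`, write `K` as a κ-filtered colimit of κ-presentable `F
i` under `A` and factor each `A ⟶ F i` functorially through some `R i`. The map `colim R ⟶ K` is in
`J.rlp`, so it has a section under `A`. Partial sections `F i ⟶ R j` are chained along a sequence of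
indices. The colimit `P` of the sequence is still κ-presentable, and the glued section makes `A ⟶ P`
a retract of a map in the class.

If `κ = ℵ₀`, such a `P` need not be finitely presentable. Instead `a` is a retract of a cell complex
of length `ω`, and factorizability survives attaching cells, filtered colimits and retracts.

For simplicial sets, every map `1 ⟶ K` is a monomorphism, so it only remains to see that acyclic
objects are nonempty. -/

/-- Morphisms `A ⟶ K` such that every map from a `κ`-presentable object to `K` factors through
a `κ`-presentable object `P` under `A` such that `A ⟶ P` is in `W`. -/
def IsPresentablyFactorizable {C : Type u} [Category.{v} C] (W : MorphismProperty C)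
    (κ : Cardinal.{w}) [Fact κ.IsRegular] {A K : C} (a : A ⟶ K) : Prop :=
  ∀ ⦃G : C⦄ (_ : IsCardinalPresentable G κ) (g : G ⟶ K),
    ∃ (P : C) (_ : IsCardinalPresentable P κ) (a' : A ⟶ P) (p : P ⟶ K) (h : G ⟶ P),
      W a' ∧ a' ≫ p = a ∧ h ≫ p = g

/-! ### Colimits: pushouts, right lifting classes, cofinal full subcategories. -/

section

variable {C : Type u} [Category.{v} C]

/-- Pointwise pushouts of diagrams commute with colimits. -/
noncomputable def isColimitOfIsPushout {D : Type*} [Category* D] {X Y K L : D ⥤ C}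
    {α : X ⟶ Y} {β : X ⟶ K} {γ : Y ⟶ L} {δ : K ⟶ L}
    (sq : ∀ d, IsPushout (α.app d) (β.app d) (γ.app d) (δ.app d))
    {cX : Cocone X} {cY : Cocone Y} {cK : Cocone K}
    (hX : IsColimit cX) (hY : IsColimit cY) (hK : IsColimit cK) (cL : Cocone L)
    {a : cX.pt ⟶ cY.pt} {b : cX.pt ⟶ cK.pt} {c : cY.pt ⟶ cL.pt} {d : cK.pt ⟶ cL.pt}
    (ha : ∀ d, cX.ι.app d ≫ a = α.app d ≫ cY.ι.app d)
    (hb : ∀ d, cX.ι.app d ≫ b = β.app d ≫ cK.ι.app d)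
    (hc : ∀ d, cY.ι.app d ≫ c = γ.app d ≫ cL.ι.app d)
    (hd : ∀ j, cK.ι.app j ≫ d = δ.app j ≫ cL.ι.app j)
    (h : IsPushout a b c d) : IsColimit cL where
  desc s := h.desc (hY.desc ⟨s.pt, γ ≫ s.ι⟩) (hK.desc ⟨s.pt, δ ≫ s.ι⟩) (hX.hom_ext fun j ↦ by
    rw [reassoc_of% ha j, reassoc_of% hb j, hY.fac, hK.fac]
    simp [reassoc_of% (sq j).w])
  fac s j := (sq j).hom_ext
    (by rw [← reassoc_of% hc j, h.inl_desc, hY.fac]; rfl)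
    (by rw [← reassoc_of% hd j, h.inr_desc, hK.fac]; rfl)
  uniq s m hm := h.hom_ext
    (hY.hom_ext fun j ↦ by rw [h.inl_desc, hY.fac, reassoc_of% hc j, hm]; rfl)
    (hK.hom_ext fun j ↦ by rw [h.inr_desc, hK.fac, reassoc_of% hd j, hm]; rfl)

/-- A morphism property defined by the right lifting property with respect to morphisms between
`κ`-presentable objects is stable under `κ`-filtered colimits. -/
lemma rlp_of_isColimit {κ : Cardinal.{w}} [Fact κ.IsRegular] {J : MorphismProperty C}
    (hJ : ∀ ⦃A B : C⦄ (f : A ⟶ B), J f → IsCardinalPresentable A κ ∧ IsCardinalPresentable B κ)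
    {I : Type*} [Category* I] [EssentiallySmall.{w} I] [IsCardinalFiltered I κ]
    {R F : I ⥤ C} (π : R ⟶ F) (hπ : ∀ i, J.rlp (π.app i))
    {cR : Cocone R} {cF : Cocone F} (hR : IsColimit cR) (hF : IsColimit cF)
    (ρ : cR.pt ⟶ cF.pt) (hρ : ∀ i, cR.ι.app i ≫ ρ = π.app i ≫ cF.ι.app i) :
    J.rlp ρ := by
  intro X Y f hf
  obtain ⟨_, _⟩ := hJ f hf
  refine ⟨fun {x y} sq ↦ ?_⟩
  have := isFiltered_of_isCardinalFiltered I κ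
  -- Since `X` and `Y` are κ-presentable, the whole square descends to one stage `k`, where `π`
  -- provides a lift.
  obtain ⟨i, x', hx⟩ := IsCardinalPresentable.exists_hom_of_isColimit κ hR x
  obtain ⟨j, y', hy⟩ := IsCardinalPresentable.exists_hom_of_isColimit κ hF y
  obtain ⟨k, u, v, huv⟩ := IsCardinalPresentable.exists_eq_of_isColimit κ hF
    (x' ≫ π.app i) (f ≫ y') (by rw [Category.assoc, Category.assoc, ← hρ, reassoc_of% hx, hy, sq.w])
  have := hπ k f hf
  have sq' : CommSq (x' ≫ R.map u) f (π.app k) (y' ≫ F.map v) := ⟨by simpa using huv⟩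
  exact ⟨⟨{ l := sq'.lift ≫ cR.ι.app k
            fac_left := by simp [hx]
            fac_right := by simp [hρ, hy] }⟩⟩

/-- A full subcategory of a `κ`-filtered category such that each object maps to an object
of the subcategory is `κ`-filtered. -/
lemma isCardinalFiltered_fullSubcategory {I : Type*} [Category* I] (κ : Cardinal.{w})
    [Fact κ.IsRegular] [IsCardinalFiltered I κ] (P : ObjectProperty I)
    (hP : ∀ i, ∃ j, P j ∧ Nonempty (i ⟶ j)) : IsCardinalFiltered P.FullSubcategory κ where
  nonempty_cocone {A _} F hA := by
    let c := IsCardinalFiltered.cocone (F ⋙ P.ι) hA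
    obtain ⟨j, hj, ⟨f⟩⟩ := hP c.pt
    exact ⟨{ pt := ⟨j, hj⟩
             ι := { app a := P.homMk (c.ι.app a ≫ f)
                    naturality a b g := by
                      ext
                      simpa using c.w_assoc g f } }⟩

lemma final_ι_fullSubcategory {I : Type*} [Category* I] [IsFiltered I] (P : ObjectProperty I)
    (hP : ∀ i, ∃ j, P j ∧ Nonempty (i ⟶ j)) : P.ι.Final :=
  Functor.final_of_exists_of_isFiltered_of_fullyFaithful _ fun i ↦ by
    obtain ⟨j, hj, h⟩ := hP i
    exact ⟨⟨j, hj⟩, h⟩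

/-- If every morphism from a `κ`-presentable object to `K` factors through a `κ`-presentable
object satisfying `P`, then `K` is a `κ`-directed colimit of such objects. -/
lemma isCardinalDirectedColimitOf_of_exists_fac (κ : Cardinal.{w}) [Fact κ.IsRegular]
    [IsCardinalLocallyPresentable C κ] (P : ObjectProperty C) (K : C)
    (hK : ∀ ⦃G : C⦄ (_ : IsCardinalPresentable G κ) (g : G ⟶ K), ∃ (H : C)
      (_ : IsCardinalPresentable H κ) (_ : P H) (h : G ⟶ H) (p : H ⟶ K), h ≫ p = g) :
    IsCardinalDirectedColimitOf (isCardinalPresentable C κ ⊓ P) κ K := by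
  let I := CostructuredArrow (isCardinalPresentable C κ).ι K
  let Q : ObjectProperty I := fun i ↦ P i.left.obj
  have hQ : ∀ i, ∃ j, Q j ∧ Nonempty (i ⟶ j) := fun i ↦ by
    obtain ⟨H, hH, hPH, h, p, hp⟩ := hK i.left.property i.hom
    let H' : (isCardinalPresentable C κ).FullSubcategory := ⟨H, hH⟩
    exact ⟨CostructuredArrow.mk (S := (isCardinalPresentable C κ).ι) (Y := H') p, hPH,
      ⟨CostructuredArrow.homMk (ObjectProperty.homMk h) hp⟩⟩
  have : IsFiltered I := isFiltered_of_isCardinalFiltered I κ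
  have := isCardinalFiltered_fullSubcategory κ Q hQ
  have := final_ι_fullSubcategory Q hQ
  have : EssentiallySmall.{w} I := inferInstance
  have : EssentiallySmall.{w} Q.FullSubcategory := essentiallySmall_of_fully_faithful Q.ι
  let e := equivSmallModel.{w} Q.FullSubcategory
  have := IsCardinalFiltered.of_equivalence κ e
  -- A small κ-filtered category receives a final functor from a κ-directed poset.
  obtain ⟨S, _, _, F, _⟩ :=
    IsCardinalFiltered.exists_cardinal_directed (SmallModel.{w} Q.FullSubcategory) κ
  let Φ : S ⥤ I := (F ⋙ e.inverse) ⋙ Q.ι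
  have hc := (isCardinalPresentable C κ).ι.denseAt K
  refine ⟨S, inferInstance, _, _, (Functor.Final.isColimitWhiskerEquiv Φ _).symm hc,
    fun T hT ↦ ?_, fun s ↦ ⟨(Φ.obj s).left.property, ((F ⋙ e.inverse).obj s).property⟩,
    ⟨Iso.refl _⟩⟩
  have hT' : HasCardinalLT T κ := by rwa [hasCardinalLT_iff_cardinal_mk_lt]
  refine ⟨IsCardinalFiltered.max (fun t : T ↦ t.1) hT', fun t ht ↦ ?_⟩
  exact leOfHom (IsCardinalFiltered.toMax (fun t : T ↦ t.1) hT' ⟨t, ht⟩)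

end

/-! ### Descending a section of a colimit to a chain of partial sections. -/

section

variable {C : Type u} [Category.{v} C]

lemma isCardinalForSmallObjectArgument_of_isCardinalPresentable (κ : Cardinal.{w})
    [Fact κ.IsRegular] [OrderBot κ.ord.ToType] [IsCardinalLocallyPresentable C κ]
    (J : MorphismProperty C) [MorphismProperty.IsSmall.{w} J]
    (hJ : ∀ ⦃A B : C⦄ (f : A ⟶ B), J f → IsCardinalPresentable A κ) :
    J.IsCardinalForSmallObjectArgument κ where
  hasPushouts := by
    have : HasFiniteColimits C := hasFiniteColimits_of_hasColimitsOfSize C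
    infer_instance
  preservesColimit i hi f hf := by
    have := hJ _ hi
    exact (preservesColimitsOfShape_of_isCardinalPresentable _ κ _).preservesColimit

/-- If `f = i ≫ p` and `p` has a section under the source of `f`, then `f` is a retract of `i`. -/
lemma CategoryTheory.MorphismProperty.mem_of_section {W : MorphismProperty C}
    [W.IsStableUnderRetracts] {X Y Z : C} {f : X ⟶ Y} {i : X ⟶ Z} {p : Z ⟶ Y} (hi : W i)
    (fac : i ≫ p = f) (s : Y ⟶ Z) (hs : s ≫ p = 𝟙 Y) (hf : f ≫ s = i) : W f :=
  MorphismProperty.of_retract (P := W)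
    { i := CategoryTheory.Arrow.homMk (𝟙 X) s (by simp [hf])
      r := CategoryTheory.Arrow.homMk (𝟙 X) p (by simp [fac])
      retract := by ext <;> simp [hs] } hi

/-- A step in the construction of a countable chain of objects under `A` with compatible morphisms
to the middle objects of their factorizations. -/
structure PartialSection {I : Type*} [Category* I] {A : C} {F R : I ⥤ C}
    (x : (Functor.const I).obj A ⟶ F) (ι : (Functor.const I).obj A ⟶ R) (π : R ⟶ F)
    {cF : Cocone F} {cR : Cocone R} (s : cF.pt ⟶ cR.pt) where
  /-- the source index -/
  src : I
  /-- the target index -/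
  tgt : I
  /-- the transition morphism -/
  hom : src ⟶ tgt
  /-- the partial section -/
  sec : F.obj src ⟶ R.obj tgt
  sec_π : sec ≫ π.app tgt = F.map hom
  x_sec : x.app src ≫ sec = ι.app tgt
  sec_ι : sec ≫ cR.ι.app tgt = cF.ι.app src ≫ s

namespace PartialSection

variable {κ : Cardinal.{w}} [Fact κ.IsRegular] {I : Type*} [Category* I] [EssentiallySmall.{w} I]
  [IsCardinalFiltered I κ] {A : C} {F R : I ⥤ C}
  {x : (Functor.const I).obj A ⟶ F} {ι : (Functor.const I).obj A ⟶ R} {π : R ⟶ F}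
  {cF : Cocone F} {cR : Cocone R} (hF : IsColimit cF) (hR : IsColimit cR)
  {s : cF.pt ⟶ cR.pt} {ρ : cR.pt ⟶ cF.pt}

include hR in
variable (κ) in
lemma exists_comp_eq {i j : I} (u : i ⟶ j) (t : F.obj i ⟶ R.obj j)
    (ht : t ≫ cR.ι.app j = cF.ι.app i ≫ s)
    {X : C} [IsCardinalPresentable X κ] (f : X ⟶ F.obj i) (g : X ⟶ R.obj i)
    (hfg : f ≫ cF.ι.app i ≫ s = g ≫ cR.ι.app i) :
    ∃ (k : I) (v : j ⟶ k), f ≫ t ≫ R.map v = g ≫ R.map (u ≫ v) := by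
  obtain ⟨k, v, hv⟩ := IsCardinalPresentable.exists_eq_of_isColimit' κ hR
    (f ≫ t) (g ≫ R.map u) (by simp [ht, hfg])
  exact ⟨k, v, by simpa using hv⟩

-- Presentability of `F i` factors the restriction of `s` through some `R j`; since `s ≫ ρ = 𝟙`, it
-- is a partial section of `π` after enlarging `j`.
include hF hR in
variable (κ) in
lemma exists_sec (hsρ : s ≫ ρ = 𝟙 _)
    (hρ : ∀ i, cR.ι.app i ≫ ρ = π.app i ≫ cF.ι.app i)
    (i : I) [IsCardinalPresentable (F.obj i) κ] :
    ∃ (j : I) (u : i ⟶ j) (t : F.obj i ⟶ R.obj j), t ≫ π.app j = F.map u ∧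
      t ≫ cR.ι.app j = cF.ι.app i ≫ s := by
  obtain ⟨j, t, ht⟩ := IsCardinalPresentable.exists_hom_of_isColimit κ hR (cF.ι.app i ≫ s)
  obtain ⟨k, v, u, h⟩ := IsCardinalPresentable.exists_eq_of_isColimit κ hF
    (t ≫ π.app j) (𝟙 (F.obj i)) (by
      rw [Category.assoc, ← hρ, reassoc_of% ht, hsρ]; simp)
  exact ⟨k, u, t ≫ R.map v, by simpa using h, by simpa using ht⟩

-- Each required equation holds in the colimit, hence at a later stage, and moving on preserves
-- those already obtained. In the chain, `f` and `g` are the previous transition map and the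
-- previous partial section.
include hF hR in
variable (κ) in
lemma exists_sec_of_comp_eq [IsCardinalPresentable A κ] (hsρ : s ≫ ρ = 𝟙 _)
    (hρ : ∀ i, cR.ι.app i ≫ ρ = π.app i ≫ cF.ι.app i)
    (hs : ∀ i, x.app i ≫ cF.ι.app i ≫ s = ι.app i ≫ cR.ι.app i)
    (i : I) [IsCardinalPresentable (F.obj i) κ]
    {X : C} [IsCardinalPresentable X κ] (f : X ⟶ F.obj i) (g : X ⟶ R.obj i)
    (hfg : f ≫ cF.ι.app i ≫ s = g ≫ cR.ι.app i) :
    ∃ (j : I) (u : i ⟶ j) (t : F.obj i ⟶ R.obj j), t ≫ π.app j = F.map u ∧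
      x.app i ≫ t = ι.app j ∧
      t ≫ cR.ι.app j = cF.ι.app i ≫ s ∧ f ≫ t = g ≫ R.map u := by
  obtain ⟨j, u, t, h₁, h₂⟩ := exists_sec κ hF hR hsρ hρ i
  obtain ⟨k, v, hv⟩ := exists_comp_eq κ hR u t h₂ f g hfg
  obtain ⟨l, w, hw⟩ := exists_comp_eq κ hR (X := A) (u ≫ v) (t ≫ R.map v) (by simpa using h₂)
    (x.app i) (ι.app i) (hs i)
  refine ⟨l, (u ≫ v) ≫ w, t ≫ R.map v ≫ R.map w, ?_, ?_, ?_, ?_⟩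
  · simp [reassoc_of% h₁]
  · rw [← Category.assoc t]
    exact hw.trans ((ι.naturality _).symm.trans (Category.id_comp _))
  · simpa using h₂
  · simpa using hv =≫ R.map w

omit [EssentiallySmall.{w} I] [IsCardinalFiltered I κ] in
lemma exists_chain (h : ∀ (i : I) ⦃X : C⦄ (_ : IsCardinalPresentable X κ)
      (f : X ⟶ F.obj i) (g : X ⟶ R.obj i) (_ : f ≫ cF.ι.app i ≫ s = g ≫ cR.ι.app i),
      ∃ (j : I) (u : i ⟶ j) (t : F.obj i ⟶ R.obj j), t ≫ π.app j = F.map u ∧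
      x.app i ≫ t = ι.app j ∧ t ≫ cR.ι.app j = cF.ι.app i ≫ s ∧ f ≫ t = g ≫ R.map u)
    [∀ i, IsCardinalPresentable (F.obj i) κ] [IsCardinalPresentable A κ]
    (hs : ∀ i, x.app i ≫ cF.ι.app i ≫ s = ι.app i ≫ cR.ι.app i) (i₀ : I) :
    ∃ (c : ℕ ⥤ I) (_ : c.obj 0 = i₀) (t : ∀ n, F.obj (c.obj n) ⟶ R.obj (c.obj (n + 1))),
      (∀ n, t n ≫ π.app _ = F.map (c.map (homOfLE n.le_succ))) ∧
      (∀ n, x.app _ ≫ t n = ι.app (c.obj (n + 1))) ∧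
      ∀ n, F.map (c.map (homOfLE n.le_succ)) ≫ t (n + 1) =
        t n ≫ R.map (c.map (homOfLE (n + 1).le_succ)) := by
  -- There is no earlier section to match at the start, so the test pair is the structure maps out
  -- of `A`, which agree by `hs`.
  obtain ⟨j₀, u₀, t₀, h₁, h₂, h₃, -⟩ := h i₀ (X := A) inferInstance (x.app i₀) (ι.app i₀) (hs i₀)
  have H (σ : PartialSection x ι π s) := h σ.tgt inferInstance (F.map σ.hom) σ.sec
    (by simp [σ.sec_ι])
  choose tgt hom sec hπ hx hι hcomp using H
  let next (σ : PartialSection x ι π s) : PartialSection x ι π s :=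
    ⟨σ.tgt, tgt σ, hom σ, sec σ, hπ σ, hx σ, hι σ⟩
  let σ (n : ℕ) : PartialSection x ι π s :=
    Nat.rec ⟨i₀, j₀, u₀, t₀, h₁, h₂, h₃⟩ (fun _ σ ↦ next σ) n
  let c : ℕ ⥤ I := Functor.ofSequence (X := fun n ↦ (σ n).src) (fun n ↦ (σ n).hom)
  have hc (n : ℕ) : c.map (homOfLE n.le_succ) = (σ n).hom :=
    Functor.ofSequence_map_homOfLE_succ _ _
  refine ⟨c, rfl, fun n ↦ (σ n).sec, fun n ↦ ?_, fun n ↦ (σ n).x_sec, fun n ↦ ?_⟩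
  · rw [hc]; exact (σ n).sec_π
  · rw [hc, hc]; exact hcomp (σ n)

end PartialSection

end

/-! ### Factorizability for uncountable `κ`. -/

section

variable {C : Type u} [Category.{v} C]

lemma hasCardinalLT_arrow_nat {κ : Cardinal.{w}} (hκ : Cardinal.aleph0 < κ) :
    HasCardinalLT (CategoryTheory.Arrow ℕ) κ := by
  have : Function.Injective (fun f : CategoryTheory.Arrow ℕ ↦ (f.left, f.right)) := by
    rintro ⟨a, b, f⟩ ⟨a', b', f'⟩ h
    obtain ⟨rfl, rfl⟩ := Prod.ext_iff.1 h
    obtain rfl := Subsingleton.elim f f'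
    rfl
  have := this.countable
  rw [HasCardinalLT]
  refine lt_of_le_of_lt (Cardinal.lift_le.2 Cardinal.mk_le_aleph0) ?_
  simpa using hκ

/-- In a locally `κ`-presentable category, an object under a `κ`-presentable object `A` is a
`κ`-filtered colimit of `κ`-presentable objects under `A`. -/
lemma exists_presentation_under (κ : Cardinal.{w}) [Fact κ.IsRegular]
    [IsCardinalLocallyPresentable C κ] {A K : C} [IsCardinalPresentable A κ] (a : A ⟶ K) :
    ∃ (I : Type w) (_ : SmallCategory I) (_ : IsCardinalFiltered I κ) (F : I ⥤ C)
      (c : F ⟶ (Functor.const I).obj K) (_ : IsColimit (Cocone.mk K c))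
      (x : (Functor.const I).obj A ⟶ F),
      (∀ i, IsCardinalPresentable (F.obj i) κ) ∧ ∀ i, x.app i ≫ c.app i = a := by
  obtain ⟨J, _, _, ⟨p⟩⟩ :=
    (isCardinalFilteredGenerator_isCardinalPresentable C κ).exists_colimitsOfShape K
  obtain ⟨j₀, a₀, ha₀⟩ := IsCardinalPresentable.exists_hom_of_isColimit κ p.isColimit a
  have : IsFiltered J := isFiltered_of_isCardinalFiltered J κ
  refine ⟨Under j₀, inferInstance, inferInstance, Under.forget j₀ ⋙ p.diag,
    Functor.whiskerLeft (Under.forget j₀) p.ι,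
    (Functor.Final.isColimitWhiskerEquiv (Under.forget j₀) _).symm p.isColimit,
    { app j := a₀ ≫ p.diag.map j.hom
      naturality i j f := by simp [← Functor.map_comp] },
    fun j ↦ p.prop_diag_obj _, fun j ↦ ?_⟩
  simpa using ha₀

/-- A morphism from a `κ`-presentable object which has the left lifting property with respect to
`J.rlp` is factorizable when `κ` is uncountable. -/
lemma isPresentablyFactorizable_of_aleph0_lt {κ : Cardinal.{w}} [Fact κ.IsRegular]
    (hκ : Cardinal.aleph0 < κ) [IsCardinalLocallyPresentable C κ]
    (J : MorphismProperty C) [MorphismProperty.IsSmall.{w} J]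
    (hJ : ∀ ⦃A B : C⦄ (f : A ⟶ B), J f → IsCardinalPresentable A κ ∧ IsCardinalPresentable B κ)
    {A K : C} [IsCardinalPresentable A κ] (a : A ⟶ K) (ha : J.rlp.llp a) :
    IsPresentablyFactorizable J.rlp.llp κ a := by
  intro G _ g
  have : Nonempty κ.ord.ToType := by simpa using Cardinal.IsRegular.ne_zero Fact.out
  let _ := WellFoundedLT.toOrderBot κ.ord.ToType
  have := isCardinalForSmallObjectArgument_of_isCardinalPresentable κ J
    (fun _ _ f hf ↦ (hJ f hf).1)
  have := SmallObject.hasFunctorialFactorization J κ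
  let data := MorphismProperty.functorialFactorizationData J.rlp.llp J.rlp
  obtain ⟨I, _, _, F, c, hF, x, hFκ, hx⟩ := exists_presentation_under κ a
  have : IsFiltered I := isFiltered_of_isCardinalFiltered I κ
  let Φ : I ⥤ CategoryTheory.Arrow C :=
    { obj i := CategoryTheory.Arrow.mk (x.app i)
      map u := CategoryTheory.Arrow.homMk (𝟙 A) (F.map u) (by simpa using x.naturality u) }
  let R : I ⥤ C := Φ ⋙ data.Z
  let π : R ⟶ F := { app i := data.p.app (Φ.obj i)
                     naturality i j u := data.p.naturality (Φ.map u) }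
  let ι : (Functor.const I).obj A ⟶ R :=
    { app i := data.i.app (Φ.obj i)
      naturality i j u := data.i.naturality (Φ.map u) }
  have hιπ i : ι.app i ≫ π.app i = x.app i := data.fac_app
  let cR := colimit.cocone R
  let ρ : cR.pt ⟶ K := colimit.desc R (Cocone.mk K (π ≫ c))
  have hρ i : cR.ι.app i ≫ ρ = π.app i ≫ c.app i := colimit.ι_desc _ _
  have hρJ : J.rlp ρ := rlp_of_isColimit hJ π (fun i ↦ data.hp _) (colimit.isColimit R) hF ρ hρ
  have hι {i j : I} (u : i ⟶ j) : ι.app i ≫ cR.ι.app i = ι.app j ≫ cR.ι.app j := by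
    rw [← cR.w u]
    exact (ι.naturality_assoc u _).symm.trans (Category.id_comp _)
  -- As `I` is filtered, the map from `A` to the colimit of `R` does not depend on the stage.
  have hι' (i j : I) : ι.app i ≫ cR.ι.app i = ι.app j ≫ cR.ι.app j :=
    (hι (IsFiltered.leftToMax i j)).trans (hι (IsFiltered.rightToMax i j)).symm
  obtain ⟨i₀, g₀, hg₀⟩ := IsCardinalPresentable.exists_hom_of_isColimit κ hF g
  have := ha ρ hρJ
  have sq : CommSq (ι.app i₀ ≫ cR.ι.app i₀) a ρ (𝟙 K) :=
    ⟨by rw [Category.assoc, hρ, reassoc_of% hιπ, hx, Category.comp_id]⟩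
  let s : K ⟶ cR.pt := sq.lift
  have hsρ : s ≫ ρ = 𝟙 K := sq.fac_right
  have has : a ≫ s = ι.app i₀ ≫ cR.ι.app i₀ := sq.fac_left
  have hs i : x.app i ≫ c.app i ≫ s = ι.app i ≫ cR.ι.app i := by
    rw [reassoc_of% hx, has, hι' i₀ i]
  obtain ⟨d, rfl, t, h₁, h₂, h₃⟩ := PartialSection.exists_chain (κ := κ) (x := x) (ι := ι) (π := π)
    (cF := Cocone.mk K c) (cR := cR) (s := s)
    (fun i X _ f g hfg ↦ PartialSection.exists_sec_of_comp_eq κ hF (colimit.isColimit R)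
      hsρ hρ hs i f g hfg) hs i₀
  have : HasColimitsOfSize.{0, 0} C := hasColimitsOfSizeShrink.{0, 0, w, w} C
  let P := colimit (d ⋙ F)
  let a' : A ⟶ P := x.app (d.obj 0) ≫ colimit.ι (d ⋙ F) 0
  have hxd n : x.app (d.obj n) ≫ colimit.ι (d ⋙ F) n = a' := by
    dsimp only [a']
    rw [← colimit.w (d ⋙ F) (homOfLE n.zero_le)]
    exact ((x.naturality_assoc (d.map (homOfLE n.zero_le)) _).symm.trans (Category.id_comp _)).symm
  have (n : ℕ) : IsCardinalPresentable ((d ⋙ F).obj n) κ := hFκ _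
  -- Uncountability of `κ` enters here: the chain is a diagram of size `< κ`.
  have : IsCardinalPresentable P κ :=
    isCardinalPresentable_of_isColimit _ (colimit.isColimit (d ⋙ F)) κ (hasCardinalLT_arrow_nat hκ)
  let q n : Φ.obj (d.obj n) ⟶ CategoryTheory.Arrow.mk a' :=
    CategoryTheory.Arrow.homMk (𝟙 A) (colimit.ι (d ⋙ F) n) 
      ((Category.id_comp _).trans (hxd n).symm)
  have hq n : Φ.map (d.map (homOfLE n.le_succ)) ≫ q (n + 1) = q n := by
    ext
    · simp [Φ, q]
    · exact colimit.w (d ⋙ F) _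
  let Z := data.Z.obj (CategoryTheory.Arrow.mk a')
  let i' : A ⟶ Z := data.i.app (CategoryTheory.Arrow.mk a')
  let p' : Z ⟶ P := data.p.app (CategoryTheory.Arrow.mk a')
  have fac : i' ≫ p' = a' := data.fac_app
  let z n : R.obj (d.obj n) ⟶ Z := data.Z.map (q n)
  have hz n : R.map (d.map (homOfLE n.le_succ)) ≫ z (n + 1) = z n :=
    (data.Z.map_comp _ _).symm.trans (congr_arg data.Z.map (hq n))
  have hzp n : z n ≫ p' = π.app (d.obj n) ≫ colimit.ι (d ⋙ F) n := data.p.naturality (q n)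
  have hiz n : ι.app (d.obj n) ≫ z n = i' :=
    (data.i.naturality (q n)).symm.trans (Category.id_comp _)
  -- The partial sections, pushed into the factorization `Z` of `a'` itself, are compatible along
  -- the chain and glue to a section of `p'` under `A`.
  let m : P ⟶ Z := colimit.desc (d ⋙ F)
    (Cocone.mk _ (NatTrans.ofSequence (G := (Functor.const ℕ).obj _)
      (fun n ↦ t n ≫ z (n + 1)) (fun n ↦ by
        rw [← hz (n + 1)]
        simpa using (h₃ n) =≫ z (n + 1 + 1))))
  have hm n : colimit.ι (d ⋙ F) n ≫ m = t n ≫ z (n + 1) := colimit.ι_desc _ _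
  refine ⟨P, inferInstance, a', colimit.desc (d ⋙ F) (Cocone.mk K (Functor.whiskerLeft d c)),
    g₀ ≫ colimit.ι (d ⋙ F) 0, MorphismProperty.mem_of_section (data.hi _) fac m
      (colimit.hom_ext fun n ↦ ?_) ?_, ?_, ?_⟩
  · rw [reassoc_of% hm n, hzp, reassoc_of% (h₁ n), Category.comp_id]
    exact colimit.w (d ⋙ F) _
  · refine (Category.assoc _ _ _).trans ?_
    rw [hm, ← hiz 1, ← h₂ 0]
    exact (Category.assoc _ _ _).symm
  · simpa [a'] using hx _
  · simpa using hg₀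

end

/-! ### Factorizability for `κ = ℵ₀`: attaching cells. -/

section

variable {C : Type u} [Category.{v} C]

namespace CategoryTheory.Limits.CoproductsFromFiniteFiltered

variable [HasFiniteCoproducts C] {T : Type w} {F : Discrete T ⥤ C}

/-- The inclusion of a summand in a finite subcoproduct. -/
noncomputable def liftToFinsetInj (F : Discrete T ⥤ C) {S : Finset (Discrete T)} {s : Discrete T}
    (hs : s ∈ S) : F.obj s ⟶ (liftToFinsetObj F).obj S :=
  Sigma.ι (fun x : S ↦ F.obj x.1) ⟨s, hs⟩

lemma liftToFinset_hom_ext {S : Finset (Discrete T)} {Z : C} {f g : (liftToFinsetObj F).obj S ⟶ Z}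
    (h : ∀ s (hs : s ∈ S), liftToFinsetInj F hs ≫ f = liftToFinsetInj F hs ≫ g) : f = g :=
  Sigma.hom_ext _ _ fun ⟨s, hs⟩ ↦ h s hs

lemma liftToFinsetInj_map {S S' : Finset (Discrete T)} (h : S ⟶ S') {s : Discrete T}
    (hs : s ∈ S) : liftToFinsetInj F hs ≫ (liftToFinsetObj F).map h =
      liftToFinsetInj F (leOfHom h hs) :=
  Sigma.ι_desc _ _

/-- The functoriality of finite subcoproducts. -/
noncomputable def liftToFinsetMap {F G : Discrete T ⥤ C} (φ : F ⟶ G) :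
    liftToFinsetObj F ⟶ liftToFinsetObj G :=
  (liftToFinset C T).map φ

lemma liftToFinsetInj_app {G : Discrete T ⥤ C} (φ : F ⟶ G) {S : Finset (Discrete T)}
    {s : Discrete T} (hs : s ∈ S) :
    liftToFinsetInj F hs ≫ (liftToFinsetMap φ).app S = φ.app s ≫ liftToFinsetInj G hs :=
  Sigma.ι_map (fun x : S ↦ φ.app x.1) ⟨s, hs⟩

/-- The morphism from a finite subcoproduct to the point of a cocone. -/
noncomputable def liftToFinsetDesc (c : Cocone F) (S : Finset (Discrete T)) :
    (liftToFinsetObj F).obj S ⟶ c.pt :=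
  Sigma.desc fun s : S ↦ c.ι.app s.1

lemma liftToFinsetInj_desc (c : Cocone F) {S : Finset (Discrete T)} {s : Discrete T}
    (hs : s ∈ S) : liftToFinsetInj F hs ≫ liftToFinsetDesc c S = c.ι.app s :=
  Sigma.ι_desc _ _

/-- The morphisms from finite subcoproducts to the point of a cocone. -/
noncomputable def liftToFinsetι (c : Cocone F) :
    liftToFinsetObj F ⟶ (Functor.const _).obj c.pt where
  app S := liftToFinsetDesc c S
  naturality S S' h := liftToFinset_hom_ext fun s hs ↦ by
    rw [reassoc_of% liftToFinsetInj_map h hs, liftToFinsetInj_desc]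
    exact (((reassoc_of% liftToFinsetInj_desc c hs) _).trans (Category.comp_id _)).symm

lemma liftToFinsetInj_ι (c : Cocone F) {S : Finset (Discrete T)} {s : Discrete T}
    (hs : s ∈ S) : liftToFinsetInj F hs ≫ (liftToFinsetι c).app S = c.ι.app s :=
  liftToFinsetInj_desc _ _

/-- A coproduct is the filtered colimit of its finite subcoproducts. -/
noncomputable def isColimitLiftToFinset {c : Cocone F} (hc : IsColimit c) :
    IsColimit (Cocone.mk c.pt (liftToFinsetι c)) where
  desc t := hc.desc (Cocone.mk t.pt (Discrete.natTrans fun j ↦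
    liftToFinsetInj F (Finset.mem_singleton_self j) ≫ t.ι.app {j}))
  fac t S := liftToFinset_hom_ext fun s hs ↦ by
    have := t.w (homOfLE (Finset.singleton_subset_iff.2 hs))
    rw [reassoc_of% @liftToFinsetInj_ι, hc.fac]
    dsimp
    rw [← this, reassoc_of% @liftToFinsetInj_map]
  uniq t m hm := hc.hom_ext fun j ↦ by
    rw [hc.fac]
    dsimp
    rw [← hm, reassoc_of% @liftToFinsetInj_ι]

end CategoryTheory.Limits.CoproductsFromFiniteFiltered

namespace IsPresentablyFactorizable

variable {W : MorphismProperty C} {κ : Cardinal.{w}} [Fact κ.IsRegular]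

lemma id [W.ContainsIdentities] (A : C) [IsCardinalPresentable A κ] :
    IsPresentablyFactorizable W κ (𝟙 A) :=
  fun _ _ g ↦ ⟨A, inferInstance, 𝟙 A, 𝟙 A, g, W.id_mem A, by simp, by simp⟩

lemma comp_iso {A K K' : C} {a : A ⟶ K} (ha : IsPresentablyFactorizable W κ a) (e : K ≅ K') :
    IsPresentablyFactorizable W κ (a ≫ e.hom) := fun G _ g ↦ by
  obtain ⟨P, _, a', p, h, h₁, h₂, h₃⟩ := ha ‹_› (g ≫ e.inv)
  exact ⟨P, inferInstance, a', p ≫ e.hom, h, h₁, by simp [reassoc_of% h₂],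
    by simp [reassoc_of% h₃]⟩

lemma of_section {A K K' : C} {a : A ⟶ K} {a' : A ⟶ K'}
    (ha' : IsPresentablyFactorizable W κ a') (s : K ⟶ K') (r : K' ⟶ K) (hsr : s ≫ r = 𝟙 K)
    (fac : a' ≫ r = a) : IsPresentablyFactorizable W κ a := fun G _ g ↦ by
  obtain ⟨P, _, a'', p, h, h₁, h₂, h₃⟩ := ha' ‹_› (g ≫ s)
  exact ⟨P, inferInstance, a'', p ≫ r, h, h₁, by rw [reassoc_of% h₂, fac],
    by rw [reassoc_of% h₃, hsr, Category.comp_id]⟩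

/-- Factorizability is detected on a `κ`-filtered colimit. -/
lemma of_isColimit {I : Type*} [Category* I] [EssentiallySmall.{w} I] [IsCardinalFiltered I κ]
    {F : I ⥤ C} {c : Cocone F} (hc : IsColimit c) {A : C} {a : A ⟶ c.pt}
    (h : ∀ i, ∃ (j : I) (_ : i ⟶ j) (b : A ⟶ F.obj j), b ≫ c.ι.app j = a ∧
      IsPresentablyFactorizable W κ b) :
    IsPresentablyFactorizable W κ a := fun G _ g ↦ by
  obtain ⟨i, g', rfl⟩ := IsCardinalPresentable.exists_hom_of_isColimit κ hc g
  obtain ⟨j, u, b, rfl, hb⟩ := h i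
  obtain ⟨P, _, a', p, h, h₁, h₂, h₃⟩ := hb ‹_› (g' ≫ F.map u)
  exact ⟨P, inferInstance, a', p ≫ c.ι.app j, h, h₁, by rw [reassoc_of% h₂],
    by simp [reassoc_of% h₃]⟩

variable [IsCardinalLocallyPresentable C κ]

lemma isCardinalPresentable_pushout {X Y Z : C} (f : X ⟶ Y) (g : X ⟶ Z) [HasPushout f g]
    [IsCardinalPresentable X κ] [IsCardinalPresentable Y κ] [IsCardinalPresentable Z κ] :
    IsCardinalPresentable (pushout f g) κ := by
  have : ∀ k, IsCardinalPresentable ((span f g).obj k) κ := by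
    rintro (_ | _ | _) <;> dsimp <;> infer_instance
  exact isCardinalPresentable_of_isColimit _ (colimit.isColimit (span f g)) κ
    (hasCardinalLT_of_finite _ _ (Cardinal.IsRegular.aleph0_le Fact.out))

/-- Attaching a cell `f ∈ W` between `κ`-presentable objects preserves factorizability. -/
lemma comp_of_isPushout [W.IsStableUnderCobaseChange] [W.IsStableUnderComposition]
    {X Y K₀ K₁ A : C} {f : X ⟶ Y} {b : X ⟶ K₀} {c : Y ⟶ K₁} {d : K₀ ⟶ K₁}
    (sq : IsPushout f b c d) (hf : W f) [IsCardinalPresentable X κ] [IsCardinalPresentable Y κ]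
    {a : A ⟶ K₀} (ha : IsPresentablyFactorizable W κ a) :
    IsPresentablyFactorizable W κ (a ≫ d) := fun G _ g ↦ by
  have : HasFiniteColimits C := hasFiniteColimits_of_hasColimitsOfSize C
  obtain ⟨I, _, _, F, c₀, hF, x, hFκ, hx⟩ := exists_presentation_under κ b
  have : IsFiltered I := isFiltered_of_isCardinalFiltered I κ
  have := IsFiltered.isConnected I
  let α : (Functor.const I).obj X ⟶ (Functor.const I).obj Y := (Functor.const I).map f
  let L := pushout α x
  let cL : L ⟶ (Functor.const I).obj K₁ := pushout.desc ((Functor.const I).map c)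
    (c₀ ≫ (Functor.const I).map d) (by ext i; simp [α, reassoc_of% hx, sq.w])
  have hL₁ i : (pushout.inl α x).app i ≫ cL.app i = c := by
    rw [← NatTrans.comp_app, pushout.inl_desc]; rfl
  have hL₂ i : (pushout.inr α x).app i ≫ cL.app i = c₀.app i ≫ d := by
    rw [← NatTrans.comp_app, pushout.inr_desc]; rfl
  have sqL (i : I) : IsPushout f (x.app i) ((pushout.inl α x).app i) ((pushout.inr α x).app i) :=
    (IsPushout.of_hasPushout α x).map ((evaluation _ _).obj i)
  -- `K₁` is the filtered colimit of the objects obtained by attaching the cell to each `F i`, so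
  -- `g` factors through one of them.
  have hL : IsColimit (Cocone.mk K₁ cL) :=
    isColimitOfIsPushout (α := α) (β := x) (γ := pushout.inl α x) (δ := pushout.inr α x) sqL
      (isColimitConstCocone I X) (isColimitConstCocone I Y) hF (Cocone.mk K₁ cL)
      (a := f) (b := b) (c := c) (d := d)
      (fun _ ↦ (Category.id_comp _).trans (Category.comp_id _).symm)
      (fun i ↦ (Category.id_comp _).trans (hx i).symm)
      (fun i ↦ (Category.id_comp _).trans (hL₁ i).symm) (fun i ↦ (hL₂ i).symm) sq
  obtain ⟨i, g', hg'⟩ := IsCardinalPresentable.exists_hom_of_isColimit κ hL g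
  -- The hypothesis is applied to the stage `F i ⟶ K₀`, which carries the attaching map `x.app i`;
  -- the cell can then be attached to `P`.
  obtain ⟨P, _, a', p, h, h₁, h₂, h₃⟩ := ha (hFκ i) (c₀.app i)
  refine ⟨pushout f (x.app i ≫ h), isCardinalPresentable_pushout _ _,
    a' ≫ pushout.inr _ _, pushout.desc c (p ≫ d) ?_,
    g' ≫ (sqL i).desc (pushout.inl _ _) (h ≫ pushout.inr _ _) ?_, ?_, ?_, ?_⟩
  · rw [Category.assoc, reassoc_of% h₃, reassoc_of% hx, sq.w]
  · simpa using pushout.condition (f := f) (g := x.app i ≫ h)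
  · exact W.comp_mem _ _ h₁ (W.of_isPushout (IsPushout.of_hasPushout f _).flip hf)
  · rw [Category.assoc, pushout.inr_desc, reassoc_of% h₂]
  · rw [← hg', Category.assoc]
    congr 1
    apply (sqL i).hom_ext
    · rw [IsPushout.inl_desc_assoc, pushout.inl_desc]
      exact (hL₁ i).symm
    · rw [IsPushout.inr_desc_assoc, Category.assoc, pushout.inr_desc, reassoc_of% h₃]
      exact (hL₂ i).symm

open CoproductsFromFiniteFiltered in
/-- Attaching a family of cells in `W` between `κ`-presentable objects preserves
factorizability when `κ = ℵ₀`. -/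
lemma comp_of_isPushout_coproduct [W.IsStableUnderCobaseChange] [W.IsStableUnderComposition]
    [MorphismProperty.IsStableUnderCoproducts.{w} W]
    (hκ : κ = Cardinal.aleph0) {T : Type w} {X Y : Discrete T ⥤ C} {f : X ⟶ Y}
    {cX : Cocone X} {cY : Cocone Y} (hX : IsColimit cX) (hY : IsColimit cY)
    {K₀ K₁ A : C} {φ : cX.pt ⟶ cY.pt} {b : cX.pt ⟶ K₀} {c : cY.pt ⟶ K₁} {d : K₀ ⟶ K₁}
    (hφ : ∀ t, cX.ι.app t ≫ φ = f.app t ≫ cY.ι.app t)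
    (sq : IsPushout φ b c d) (hf : ∀ t, W (f.app t))
    [∀ t, IsCardinalPresentable (X.obj t) κ] [∀ t, IsCardinalPresentable (Y.obj t) κ]
    {a : A ⟶ K₀} (ha : IsPresentablyFactorizable W κ a) :
    IsPresentablyFactorizable W κ (a ≫ d) := by
  have : HasFiniteColimits C := hasFiniteColimits_of_hasColimitsOfSize C
  -- Finite subfamilies form a merely ℵ₀-filtered poset, hence the restriction on `κ`.
  have : IsCardinalFiltered (Finset (Discrete T)) κ := by
    subst hκ
    rw [isCardinalFiltered_aleph0_iff]
    infer_instance
  have := IsFiltered.isConnected (Finset (Discrete T))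
  let α : liftToFinsetObj X ⟶ liftToFinsetObj Y := liftToFinsetMap f
  let β : liftToFinsetObj X ⟶ (Functor.const _).obj K₀ :=
    liftToFinsetι cX ≫ (Functor.const _).map b
  let L := pushout α β
  have hα : α ≫ liftToFinsetι cY = liftToFinsetι cX ≫ (Functor.const _).map φ := by
    ext S
    refine liftToFinset_hom_ext fun s hs ↦ ?_
    rw [NatTrans.comp_app, reassoc_of% @liftToFinsetInj_app, liftToFinsetInj_ι, NatTrans.comp_app,
      reassoc_of% @liftToFinsetInj_ι]
    exact (hφ s).symm
  let cL : L ⟶ (Functor.const _).obj K₁ := pushout.desc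
    (liftToFinsetι cY ≫ (Functor.const _).map c) ((Functor.const _).map d) (by
      rw [reassoc_of% hα, ← Functor.map_comp, sq.w]
      simp [β])
  have hL₁ S : (pushout.inl α β).app S ≫ cL.app S = (liftToFinsetι cY).app S ≫ c := by
    rw [← NatTrans.comp_app, pushout.inl_desc]; rfl
  have hL₂ S : (pushout.inr α β).app S ≫ cL.app S = d := by
    rw [← NatTrans.comp_app, pushout.inr_desc]; rfl
  have sqL S : IsPushout (α.app S) (β.app S) ((pushout.inl α β).app S) ((pushout.inr α β).app S) :=
    (IsPushout.of_hasPushout α β).map ((evaluation _ _).obj S)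
  have hL : IsColimit (Cocone.mk K₁ cL) :=
    isColimitOfIsPushout (α := α) (β := β) (γ := pushout.inl α β) (δ := pushout.inr α β) sqL
      (isColimitLiftToFinset hX) (isColimitLiftToFinset hY)
      (isColimitConstCocone _ K₀) (Cocone.mk K₁ cL)
      (a := φ) (b := b) (c := c) (d := d)
      (fun S ↦ (NatTrans.congr_app hα S).symm)
      (fun i ↦ (Category.comp_id _).symm)
      (fun S ↦ (hL₁ S).symm) (fun S ↦ (Category.id_comp _).trans (hL₂ S).symm) sq
  have hα' S : W (α.app S) := MorphismProperty.colimMap _ (fun ⟨s⟩ ↦ hf s.1)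
  have hκ' (Z : Discrete T ⥤ C) (hZ : ∀ t, IsCardinalPresentable (Z.obj t) κ) (S) :
      IsCardinalPresentable ((liftToFinsetObj Z).obj S) κ := by
    have (k : Discrete S) :
        IsCardinalPresentable ((Discrete.functor fun s : S ↦ Z.obj s.1).obj k) κ := hZ _
    exact isCardinalPresentable_of_isColimit _
      (colimit.isColimit (Discrete.functor fun s : S ↦ Z.obj s.1)) κ
      (hasCardinalLT_of_finite _ _ (Cardinal.IsRegular.aleph0_le Fact.out))
  have := hκ' X inferInstance
  have := hκ' Y inferInstance
  -- A finite subfamily of cells is a single cell between κ-presentable objects.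
  exact of_isColimit hL fun S ↦ ⟨S, 𝟙 S, a ≫ (pushout.inr α β).app S,
    (Category.assoc _ _ _).trans (congr_arg _ (hL₂ S)), comp_of_isPushout (sqL S) (hα' S) ha⟩

lemma comp_of_pushouts_coproducts [W.IsStableUnderCobaseChange] [W.IsStableUnderComposition]
    [MorphismProperty.IsStableUnderCoproducts.{w} W]
    (hκ : κ = Cardinal.aleph0) {J : MorphismProperty C} (hJW : J ≤ W)
    (hJ : ∀ ⦃A B : C⦄ (f : A ⟶ B), J f → IsCardinalPresentable A κ ∧ IsCardinalPresentable B κ)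
    {K₀ K₁ A : C} (d : K₀ ⟶ K₁) (hd : (MorphismProperty.coproducts.{w} J).pushouts d)
    {a : A ⟶ K₀} (ha : IsPresentablyFactorizable W κ a) :
    IsPresentablyFactorizable W κ (a ≫ d) := by
  obtain ⟨X, Y, f, b, c, hf, sq⟩ := hd
  rw [MorphismProperty.coproducts_iff] at hf
  obtain ⟨T, hf⟩ := hf
  obtain ⟨X, Y, c₁, c₂, h₁, h₂, φ, hφ⟩ := hf
  have (t : Discrete T) : IsCardinalPresentable (X.obj t) κ := (hJ _ (hφ t)).1
  have (t : Discrete T) : IsCardinalPresentable (Y.obj t) κ := (hJ _ (hφ t)).2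
  exact comp_of_isPushout_coproduct hκ h₁ h₂ (f := φ) (fun t ↦ h₁.fac _ _) sq.flip
    (fun t ↦ hJW _ (hφ t)) ha

end IsPresentablyFactorizable

open IsPresentablyFactorizable in
/-- A morphism from an `ℵ₀`-presentable object which has the left lifting property with respect to
`J.rlp` is factorizable. -/
lemma isPresentablyFactorizable_of_eq_aleph0 {κ : Cardinal.{w}} [Fact κ.IsRegular]
    (hκ : κ = Cardinal.aleph0) [IsCardinalLocallyPresentable C κ]
    (J : MorphismProperty C) [MorphismProperty.IsSmall.{w} J]
    (hJ : ∀ ⦃A B : C⦄ (f : A ⟶ B), J f → IsCardinalPresentable A κ ∧ IsCardinalPresentable B κ)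
    {A K : C} [IsCardinalPresentable A κ] (a : A ⟶ K) (ha : J.rlp.llp a) :
    IsPresentablyFactorizable J.rlp.llp κ a := by
  have : Nonempty κ.ord.ToType := by simpa using Cardinal.IsRegular.ne_zero Fact.out
  let _ := WellFoundedLT.toOrderBot κ.ord.ToType
  have := isCardinalForSmallObjectArgument_of_isCardinalPresentable κ J
    (fun _ _ f hf ↦ (hJ f hf).1)
  -- The small object argument has length `ω`, so induction over `ℕ` involves no limit step before
  -- the final colimit.
  let e : ℕ ≃o κ.ord.ToType :=
    ULift.orderIso.{w}.symm.trans
      (OrderIso.ofRelIsoLT (Nonempty.some (by subst hκ; simp [← Ordinal.type_eq])))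
  obtain ⟨h⟩ := SmallObject.transfiniteCompositionsOfShape_ιObj J κ a
  replace h := h.ofOrderIso e
  have key (n : ℕ) : IsPresentablyFactorizable J.rlp.llp κ
      (h.isoBot.inv ≫ h.F.map (homOfLE n.zero_le)) := by
    induction n with
    | zero =>
      have := (IsPresentablyFactorizable.id (W := J.rlp.llp) (κ := κ) A).comp_iso h.isoBot.symm
      rw [Category.id_comp] at this
      simpa using this
    | succ n ih =>
      have := comp_of_pushouts_coproducts hκ J.le_llp_rlp hJ _ (h.map_mem n (by simp)) ih
      rwa [Category.assoc, ← Functor.map_comp] at this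
  have : IsCardinalFiltered ℕ κ := by
    subst hκ
    rw [isCardinalFiltered_aleph0_iff]
    infer_instance
  have : IsPresentablyFactorizable J.rlp.llp κ (SmallObject.ιObj J κ a) :=
    of_isColimit.{w} h.isColimit fun n ↦ ⟨n, 𝟙 n, _,
      (Category.assoc _ _ _).trans ((congr_arg _ (Cocone.w (Cocone.mk _ h.incl) _)).trans h.fac),
      key n⟩
  have := ha _ (SmallObject.rlp_πObj J κ a)
  have sq : CommSq (SmallObject.ιObj J κ a) a (SmallObject.πObj J κ a) (𝟙 K) := ⟨by simp⟩
  -- Lifting `a` against `πObj` exhibits `K` as a retract, under `A`, of the cell complex.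
  exact of_section ‹_› sq.lift _ sq.fac_right (by simp)

end

/-! ### Acyclic objects in κ-combinatorial model categories. -/

section

variable {C : Type u} [Category.{v} C]

/-- In a locally `κ`-presentable category, if `J` is a set of morphisms between `κ`-presentable
objects, any morphism from a `κ`-presentable object which has the left lifting property with
respect to `J.rlp` is factorizable. -/
lemma isPresentablyFactorizable_llp_rlp {κ : Cardinal.{w}} [Fact κ.IsRegular]
    [IsCardinalLocallyPresentable C κ]
    (J : MorphismProperty C) [MorphismProperty.IsSmall.{w} J]
    (hJ : ∀ ⦃A B : C⦄ (f : A ⟶ B), J f → IsCardinalPresentable A κ ∧ IsCardinalPresentable B κ)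
    {A K : C} [IsCardinalPresentable A κ] (a : A ⟶ K) (ha : J.rlp.llp a) :
    IsPresentablyFactorizable J.rlp.llp κ a := by
  obtain hκ | hκ := (Cardinal.IsRegular.aleph0_le (Fact.out : κ.IsRegular)).eq_or_lt
  · exact isPresentablyFactorizable_of_eq_aleph0 hκ.symm J hJ a ha
  · exact isPresentablyFactorizable_of_aleph0_lt hκ J hJ a ha

variable [ModelCategory C]

/-- In a `κ`-combinatorial model category with a `κ`-presentable terminal object, an acyclic
object `K` such that `K ⟶ ⊤_ C` is split by a cofibration is a `κ`-directed colimit of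
`κ`-presentable acyclic objects. -/
lemma isCardinalDirectedColimitOf_acyclicObjects (κ : Cardinal.{w}) [Fact κ.IsRegular]
    [IsCardinalCombinatorial C κ] [IsCardinalPresentable (⊤_ C) κ] (K : C)
    (hK : acyclicObjects C K) (s : ⊤_ C ⟶ K) [Cofibration s] :
    IsCardinalDirectedColimitOf (isCardinalPresentable C κ ⊓ acyclicObjects C) κ K := by
  obtain ⟨J, _, hJ, hJ'⟩ := IsCardinalCombinatorial.trivialCofibrations_generated (C := C) (κ := κ)
  have : WeakEquivalence (terminal.from K) := hK
  have : WeakEquivalence s := weakEquivalence_of_postcomp_of_fac (g := terminal.from K)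
    (Subsingleton.elim _ (𝟙 _))
  have hJW : J.rlp.llp = trivialCofibrations C := by rw [← hJ', fibrations_llp]
  have hs : J.rlp.llp s := by
    rw [hJW]
    exact mem_trivialCofibrations s
  refine isCardinalDirectedColimitOf_of_exists_fac κ _ K fun G _ g ↦ ?_
  obtain ⟨P, hP, s', p, h, hs', -, fac⟩ :=
    isPresentablyFactorizable_llp_rlp J hJ s hs ‹_› g
  rw [hJW] at hs'
  have : WeakEquivalence s' := (weakEquivalence_iff _).2 hs'.2
  -- The composite `1 ⟶ P ⟶ 1` is the identity, so two-out-of-three makes `P` acyclic.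
  exact ⟨P, hP, weakEquivalence_of_precomp_of_fac (f := s') (Subsingleton.elim _ (𝟙 _)),
    h, p, fac⟩

end

/-! ### The Kan–Quillen model structure. -/

namespace SSet

open Simplicial

attribute [local instance] Cardinal.fact_isRegular_aleph0

instance : IsCardinalLocallyPresentable SSet.{w} Cardinal.aleph0.{w} := by
  have : (uliftYoneda.{w} (C := SimplexCategory)).IsDense := inferInstance
  refine (IsCardinalLocallyPresentable.iff_exists_isStrongGenerator SSet.{w} _).2
    ⟨.ofObj (uliftYoneda.{w} (C := SimplexCategory)).obj, inferInstance,
      Functor.isStrongGenerator_of_isDense _, ?_⟩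
  rintro _ ⟨n⟩
  exact inferInstanceAs (IsFinitelyPresentable.{w} (stdSimplex.{w}.obj n))

instance : IsFinitelyPresentable.{w} (⊤_ SSet.{w}) :=
  have : IsCardinalPresentable (Δ[0] : SSet.{w}) Cardinal.aleph0.{w} :=
    inferInstanceAs (IsFinitelyPresentable.{w} Δ[0])
  have e : (Δ[0] : SSet.{w}) ≅ ⊤_ SSet.{w} :=
    stdSimplex.isTerminalObj₀.uniqueUpToIso terminalIsTerminal
  isCardinalPresentable_of_iso e Cardinal.aleph0.{w}

lemma isSmall_I : MorphismProperty.IsSmall.{w} modelCategoryQuillen.I.{w} :=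
  MorphismProperty.isSmall_ofHoms.{w} _

lemma isSmall_J : MorphismProperty.IsSmall.{w} modelCategoryQuillen.J.{w} :=
  have (n : ℕ) : MorphismProperty.IsSmall.{w}
      (MorphismProperty.ofHoms fun i ↦ Λ[n + 1, i].ι : MorphismProperty SSet.{w}) :=
    MorphismProperty.isSmall_ofHoms.{w} _
  MorphismProperty.isSmall_iSup.{w} _

lemma isCardinalCombinatorial [M : ModelCategory SSet.{w}] (hM : IsKanQuillen M) :
    IsCardinalCombinatorial SSet.{w} Cardinal.aleph0.{w} where
  cofibrations_generated := by
    have hcof : cofibrations SSet.{w} = _ := hM.1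
    refine ⟨_, isSmall_I, ?_, ?_⟩
    · rintro _ _ _ ⟨n⟩
      exact ⟨inferInstanceAs (IsFinitelyPresentable.{w} (∂Δ[n] : SSet.{w})),
        inferInstanceAs (IsFinitelyPresentable.{w} Δ[n])⟩
    · rw [← rlp_monomorphisms, ← hcof, cofibrations_rlp]
  trivialCofibrations_generated := by
    refine ⟨_, isSmall_J, ?_, hM.2⟩
    intro _ _ _ hf
    simp only [modelCategoryQuillen.J, MorphismProperty.iSup_iff] at hf
    obtain ⟨n, ⟨i⟩⟩ := hf
    exact ⟨inferInstanceAs (IsFinitelyPresentable.{w} (Λ[n + 1, i] : SSet.{w})),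
      inferInstanceAs (IsFinitelyPresentable.{w} Δ[n + 1])⟩

lemma cofibration_of_mono [M : ModelCategory SSet.{w}] (hM : IsKanQuillen M)
    {X Y : SSet.{w}} (f : X ⟶ Y) [Mono f] : Cofibration f := by
  have hcof : cofibrations SSet.{w} = _ := hM.1
  rw [HomotopicalAlgebra.cofibration_iff, hcof]
  exact MorphismProperty.monomorphisms.infer_property f

/-- If `K` were empty, `K ⟶ 1` would be a trivial cofibration and, horns being nonempty, vacuously a
Kan fibration. Lifting it against itself would give a point of `K`. -/
lemma exists_terminal_hom_of_acyclic [M : ModelCategory SSet.{w}] (hM : IsKanQuillen M)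
    (K : SSet.{w}) (hK : acyclicObjects SSet.{w} K) :
    Nonempty (⊤_ SSet.{w} ⟶ K) := by
  by_cases hK' : K.Nonempty
  · exact ⟨stdSimplex.isTerminalObj₀.from _ ≫ yonedaEquiv.symm hK'.some⟩
  have : Mono (terminal.from K) := ⟨fun f g _ ↦ by
    ext n x
    exact (hK' ⟨K.map (SimplexCategory.const _ _ 0).op (f.app n x)⟩).elim⟩
  have := cofibration_of_mono hM (terminal.from K)
  have : WeakEquivalence (terminal.from K) := hK
  have : Fibration (terminal.from K) := by
    have hfib : fibrations SSet.{w} = _ := hM.2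
    rw [HomotopicalAlgebra.fibration_iff, hfib]
    intro X Y f hf
    simp only [modelCategoryQuillen.J, MorphismProperty.iSup_iff] at hf
    obtain ⟨n, ⟨i⟩⟩ := hf
    -- The horn has dimension `n + 1 ≥ 1`, so it contains a face opposite some vertex `j ≠ i` and
    -- cannot map to an empty `K`.
    obtain ⟨j, hj⟩ := exists_ne i
    exact ⟨fun {x _} _ ↦ (hK' (nonempty_of_hom (horn.ι i j hj ≫ x))).elim⟩
  have sq : CommSq (𝟙 K) (terminal.from K) (terminal.from K) (𝟙 _) := ⟨by simp⟩
  exact ⟨sq.lift⟩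

end SSet

theorem corollary5p6 :
    (∀ (κ : Cardinal.{w}) [Fact κ.IsRegular] (C : Type u) [Category.{v} C] [ModelCategory C]
      [IsCardinalCombinatorial C κ],
      IsCardinalPresentable (⊤_ C) κ →
      (∀ K : C, acyclicObjects C K →
        ∃ s : ⊤_ C ⟶ K, Cofibration s ∧ s ≫ terminal.from K = 𝟙 (⊤_ C)) →
      ∀ K : C, acyclicObjects C K →
        IsCardinalDirectedColimitOf (isCardinalPresentable C κ ⊓ acyclicObjects C) κ K) ∧
    (∀ [M : ModelCategory SSet.{w}], IsKanQuillen M →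
      ∀ K : SSet.{w}, acyclicObjects SSet.{w} K →
        ∃ (S : Type w) (_ : PartialOrder S) (_ : Nonempty S) (_ : IsDirectedOrder S)
          (D : S ⥤ SSet.{w}) (c : Cocone D) (_ : IsColimit c),
          (∀ s, IsFinitelyPresentable.{w} (D.obj s) ∧ acyclicObjects SSet.{w} (D.obj s)) ∧
            Nonempty (c.pt ≅ K)) := by
  refine ⟨fun κ _ C _ _ _ _ h K hK ↦ ?_, fun {M} hM K hK ↦ ?_⟩
  · obtain ⟨s, _, -⟩ := h K hK
    exact isCardinalDirectedColimitOf_acyclicObjects κ K hK s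
  · have : Fact (Cardinal.IsRegular Cardinal.aleph0.{w}) := Cardinal.fact_isRegular_aleph0
    have := SSet.isCardinalCombinatorial hM
    have : IsCardinalPresentable (⊤_ SSet.{w}) Cardinal.aleph0.{w} :=
      inferInstanceAs (IsFinitelyPresentable.{w} (⊤_ SSet.{w}))
    obtain ⟨s⟩ := SSet.exists_terminal_hom_of_acyclic hM K hK
    have := SSet.cofibration_of_mono hM s
    obtain ⟨S, _, D, c, hc, hS, hD, e⟩ :=
      isCardinalDirectedColimitOf_acyclicObjects Cardinal.aleph0.{w} K hK s
    obtain ⟨x, -⟩ := hS ∅ (Cardinal.mk_lt_aleph0_iff.2 inferInstance)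
    exact ⟨S, inferInstance, ⟨x⟩, ⟨fun a b ↦ by
      obtain ⟨c, hc⟩ := hS {a, b} (Cardinal.mk_lt_aleph0_iff.2 inferInstance)
      exact ⟨c, hc (by simp), hc (by simp)⟩⟩, D, c, hc, hD, e⟩
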